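/- Let $k$ be a field of characteristic $2$, let $k^{1/2}$ denote the extension of $k$ obtained by adjoining the square roots of all elements of $k$, and let $X \subset \mathbb{P}^4_k$ be a smooth complete intersection of two quadrics, that is, the closed subscheme $X = V(q_0,q_1)$ defined by two quadratic forms $q_0, q_1 \in k[x_0,\dots,x_4]$, where $X$ is smooth over $k$ and of dimension $2$. Then $X(k^{1/2}) \neq \emptyset$. If moreover $k$ is a local or global field of characteristic $2$, then $[k^{1/2}:k] = 2$; in particular, every such $X$ has a point over a quadratic extension of $k$, namely $k^{1/2}$. -/

import Mathlib

open AlgebraicGeometry CategoryTheory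

universe u

/-- Two quadratic forms `q₀, q₁` in the variables `x₀, …, x₄` over `k`: the defining equations of an
intersection of two quadrics in `ℙ⁴`. -/
structure QuadricPair (k : Type u) [Field k] where
  form : Fin 2 → MvPolynomial (Fin 5) k
  isHomogeneous : ∀ i, (form i).IsHomogeneous 2

namespace QuadricPair

variable {k : Type u} [Field k] (X : QuadricPair k)

/-- The homogeneous ideal `(q₀, q₁)` of `k[x₀, …, x₄]`. -/
noncomputable def ideal : Ideal (MvPolynomial (Fin 5) k) :=
  Ideal.span (Set.range X.form)

/-- The homogeneous coordinate ring `k[x₀, …, x₄] / (q₀, q₁)`. -/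
noncomputable abbrev CoordRing : Type u :=
  MvPolynomial (Fin 5) k ⧸ X.ideal

/-- The degree `d` part of the homogeneous coordinate ring: the classes of the forms of degree
`d`. -/
noncomputable def grading (d : ℕ) : Submodule k X.CoordRing :=
  (MvPolynomial.homogeneousSubmodule (Fin 5) k d).map (Ideal.Quotient.mkₐ k X.ideal).toLinearMap

theorem mk_mem_grading {d : ℕ} {p : MvPolynomial (Fin 5) k} (hp : p.IsHomogeneous d) :
    Ideal.Quotient.mk X.ideal p ∈ X.grading d :=
  ⟨p, (MvPolynomial.mem_homogeneousSubmodule d p).mpr hp, rfl⟩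

instance : SetLike.GradedMonoid X.grading where
  one_mem := X.mk_mem_grading (MvPolynomial.isHomogeneous_one (Fin 5) k)
  mul_mem := by
    rintro i j _ _ ⟨p, hp, rfl⟩ ⟨q, hq, rfl⟩
    exact X.mk_mem_grading
      (((MvPolynomial.mem_homogeneousSubmodule i p).mp hp).mul
        ((MvPolynomial.mem_homogeneousSubmodule j q).mp hq))

attribute [local instance] MvPolynomial.gradedAlgebra

/-- The quotient map `k[x₀, …, x₄]_d → (k[x₀, …, x₄] / (q₀, q₁))_d`. -/
noncomputable def gradedMk (d : ℕ) :
    MvPolynomial.homogeneousSubmodule (Fin 5) k d →ₗ[k] X.grading d :=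
  (Ideal.Quotient.mkₐ k X.ideal).toLinearMap.restrict fun p hp => ⟨p, hp, rfl⟩

/-- A polynomial goes to the family of the classes of its homogeneous components. -/
noncomputable def decomposeMk :
    MvPolynomial (Fin 5) k →ₐ[k] DirectSum ℕ fun d => X.grading d :=
  (DirectSum.toAlgebra k (fun d => MvPolynomial.homogeneousSubmodule (Fin 5) k d)
    (fun d => (DirectSum.lof k ℕ (fun d => X.grading d) d).comp (X.gradedMk d))
    rfl
    (fun {i j} a b => by
      simp only [LinearMap.comp_apply, DirectSum.lof_eq_of]
      rw [DirectSum.of_mul_of]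
      rfl)).comp
  (DirectSum.decomposeAlgEquiv
    (fun d => MvPolynomial.homogeneousSubmodule (Fin 5) k d)).toAlgHom

theorem decomposeMk_of_isHomogeneous {d : ℕ} {p : MvPolynomial (Fin 5) k}
    (hp : p.IsHomogeneous d) :
    X.decomposeMk p =
      DirectSum.of (fun d => X.grading d) d
        ⟨Ideal.Quotient.mk X.ideal p, X.mk_mem_grading hp⟩ := by
  have h : DirectSum.decompose (fun d => MvPolynomial.homogeneousSubmodule (Fin 5) k d) p =
      DirectSum.of (fun d => MvPolynomial.homogeneousSubmodule (Fin 5) k d) d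
        ⟨p, (MvPolynomial.mem_homogeneousSubmodule d p).mpr hp⟩ :=
    DirectSum.decompose_of_mem _ _
  simp only [decomposeMk, AlgHom.comp_apply]
  change DirectSum.toAlgebra k _ _ _ _ (DirectSum.decompose _ p) = _
  rw [h]
  erw [DirectSum.toAlgebra_apply, DirectSum.toSemiring_of]
  rfl

/-- The homogeneous coordinate ring is graded by degree. -/
noncomputable instance : GradedAlgebra X.grading :=
  GradedAlgebra.ofAlgHom X.grading
    (Ideal.Quotient.liftₐ X.ideal X.decomposeMk (by
      intro a ha
      have hle : X.ideal ≤ RingHom.ker X.decomposeMk := by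
        refine Ideal.span_le.mpr ?_
        rintro _ ⟨i, rfl⟩
        change X.decomposeMk (X.form i) = 0
        rw [X.decomposeMk_of_isHomogeneous (X.isHomogeneous i)]
        have : (⟨Ideal.Quotient.mk X.ideal (X.form i),
            X.mk_mem_grading (X.isHomogeneous i)⟩ : X.grading 2) = 0 :=
          Subtype.ext (Ideal.Quotient.eq_zero_iff_mem.mpr (Ideal.subset_span ⟨i, rfl⟩))
        rw [this, map_zero]
      exact hle ha))
    (by
      apply Ideal.Quotient.algHom_ext
      apply MvPolynomial.algHom_ext
      intro i
      have h := X.decomposeMk_of_isHomogeneous (MvPolynomial.isHomogeneous_X k i)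
      simp only [AlgHom.comp_apply, Ideal.Quotient.mkₐ_eq_mk, AlgHom.id_apply]
      change DirectSum.coeAlgHom X.grading (X.decomposeMk (MvPolynomial.X i)) = _
      rw [h]
      exact DirectSum.coeAlgHom_of _ _ _)
    (by
      rintro d ⟨_, p, hp, rfl⟩
      exact X.decomposeMk_of_isHomogeneous ((MvPolynomial.mem_homogeneousSubmodule d p).mp hp))

/-- The closed subscheme `X = V(q₀, q₁)` of `ℙ⁴_k`, that is `Proj k[x₀, …, x₄] / (q₀, q₁)`. -/
noncomputable abbrev scheme : Scheme.{u} :=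
  Proj X.grading

/-- The structure morphism `X ⟶ Spec k`. -/
noncomputable def structureMorphism : X.scheme ⟶ Spec (CommRingCat.of k) :=
  Proj.toSpecZero X.grading ≫ Spec.map (CommRingCat.ofHom (algebraMap k (X.grading 0)))

/-- `X` is a smooth complete intersection of two quadrics in `ℙ⁴_k`: it is smooth over `k`, and has
codimension two in `ℙ⁴_k`, the number of its equations (so that its dimension is two). -/
def IsSmoothCompleteIntersection : Prop :=
  Smooth X.structureMorphism ∧ topologicalKrullDim X.scheme = 2

/-- `X(L)`: the morphisms of `k`-schemes `Spec L ⟶ X`. -/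
def Point (L : Type u) [Field L] [Algebra k L] : Type u :=
  { x : Spec (CommRingCat.of L) ⟶ X.scheme //
    x ≫ X.structureMorphism = Spec.map (CommRingCat.ofHom (algebraMap k L)) }

end QuadricPair

/-- A local field: a nonarchimedean local field (for a suitable valuation and its topology), or a
field isomorphic to `ℝ` or `ℂ`. -/
def IsLocalField (k : Type u) [Field k] : Prop :=
  (∃ (_ : ValuativeRel k) (_ : TopologicalSpace k), IsNonarchimedeanLocalField k) ∨
    Nonempty (k ≃+* ℝ) ∨ Nonempty (k ≃+* ℂ)

/-- A global field: a number field, or a finite extension of the field of rational functions `F(t)`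
over a finite field `F`. -/
def IsGlobalField (k : Type u) [Field k] : Prop :=
  NumberField k ∨
    ∃ (F : Type) (_ : Field F) (_ : Finite F) (_ : Algebra (RatFunc F) k), FunctionField F k

/-!
In characteristic two the polar forms of `q₀` and `q₁` are alternating. An alternating form on a
space of odd dimension is degenerate; splitting off a vector of its radical again and again, one
finds in dimension five a subspace of dimension three that is totally isotropic for both polar
forms. On this subspace `q₀` and `q₁` are diagonal, so over `k^{1/2}` they become squares of linear
forms, and two linear forms in three variables have a common nontrivial zero.

The degree `[k^{1/p} : k]` does not change under finite extensions of `k`, and it is `p` as soon as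
`k` is generated over `k^p` by one element outside `k^p`. For rational functions over a perfect
field this element is the variable. For a complete discretely valued field with perfect residue
field it is a uniformizer `π`: every integer of the field is `∑ aᵢ ^ p * π ^ i`, `i < p`, because it
is so modulo `π ^ p` and the ring of integers is complete.
-/

open Module

/-! ### Alternating forms -/

section AlternatingForm

variable {K V : Type*} [Field K] [AddCommGroup V] [Module K V]

theorem sup_span_singleton_le_orthogonal {B : LinearMap.BilinForm K V} (hB : B.IsAlt)
    {W : Submodule K V} {x : V} (hW : W ≤ B.orthogonal W) (hx : x ∈ B.orthogonal W) :
    W ⊔ K ∙ x ≤ B.orthogonal (W ⊔ K ∙ x) := by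
  intro y hy z hz
  simp only [Submodule.mem_sup, Submodule.mem_span_singleton] at hy hz
  obtain ⟨w, hw, _, ⟨a, rfl⟩, rfl⟩ := hy
  obtain ⟨w', hw', _, ⟨b, rfl⟩, rfl⟩ := hz
  have hw'w : B w' w = 0 := hW hw w' hw'
  have hw'x : B w' x = 0 := hx w' hw'
  have hxw : B x w = 0 := hB.isRefl.eq_zero (hx w hw)
  simp [hw'w, hw'x, hxw, hB x]

theorem even_finrank_range_of_isAlt [FiniteDimensional K V] {B : LinearMap.BilinForm K V}
    (hB : B.IsAlt) : Even (finrank K (LinearMap.range B)) := by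
  obtain ⟨W, hW⟩ := exists_maximal_of_wellFoundedGT (fun W => W ≤ B.orthogonal W) ⟨⊥, bot_le⟩
  have hle : B.orthogonal W ≤ W := fun x hx =>
    hW.le_of_ge (sup_span_singleton_le_orthogonal hB hW.prop hx) le_sup_left
      (Submodule.mem_sup_right (Submodule.mem_span_singleton_self x))
  have hker : LinearMap.ker B ≤ W := fun x hx =>
    hle fun w _ => hB.isRefl.eq_zero (LinearMap.congr_fun hx w)
  have hW₂ := LinearMap.BilinForm.finrank_add_finrank_orthogonal' (B := B) W
  rw [hle.antisymm hW.prop, inf_eq_right.mpr hker] at hW₂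
  have hrank := LinearMap.finrank_range_add_finrank_ker B
  exact ⟨finrank K W - finrank K (LinearMap.ker B), by omega⟩

theorem exists_ne_zero_mem_orthogonal_of_odd_finrank {B : LinearMap.BilinForm K V}
    (hB : B.IsAlt) {S : Submodule K V} (hS : Odd (finrank K S)) :
    ∃ x ∈ S, x ≠ 0 ∧ x ∈ B.orthogonal S := by
  have : FiniteDimensional K S := Module.finite_of_finrank_pos hS.pos
  have hker : Odd (finrank K (LinearMap.ker (B.restrict S))) := by
    rw [← LinearMap.finrank_range_add_finrank_ker (B.restrict S)] at hS
    exact (Nat.odd_add'.mp hS).mpr (even_finrank_range_of_isAlt fun x => hB x)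
  obtain ⟨x, hx, hx0⟩ := Submodule.exists_mem_ne_zero_of_ne_bot
    (Submodule.one_le_finrank_iff.mp hker.pos)
  exact ⟨x, x.2, Subtype.coe_ne_coe.mpr hx0,
    fun w hw => hB.isRefl.eq_zero (LinearMap.congr_fun hx ⟨w, hw⟩)⟩

theorem exists_le_finrank_eq {S : Submodule K V} {n : ℕ} (h : n ≤ finrank K S) :
    ∃ T ≤ S, finrank K T = n := by
  obtain ⟨v, hv⟩ := exists_linearIndependent_of_le_finrank h
  exact ⟨(Submodule.span K (Set.range v)).map S.subtype, Submodule.map_subtype_le _ _, by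
    rw [Submodule.finrank_map_subtype_eq, finrank_span_eq_card hv, Fintype.card_fin]⟩

theorem exists_isotropic_of_two_mul_le_finrank_add_one [FiniteDimensional K V]
    {B₀ B₁ : LinearMap.BilinForm K V} (h₀ : B₀.IsAlt) (h₁ : B₁.IsAlt) {m : ℕ} {S : Submodule K V}
    (hS : 2 * m ≤ finrank K S + 1) :
    ∃ W ≤ S, finrank K W = m ∧ W ≤ B₀.orthogonal W ∧ W ≤ B₁.orthogonal W := by
  induction m generalizing S with
  | zero => exact ⟨⊥, bot_le, finrank_bot K V, bot_le, bot_le⟩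
  | succ m ih =>
    obtain ⟨T, hTS, hT⟩ := exists_le_finrank_eq (show 2 * m + 1 ≤ finrank K S by omega)
    obtain ⟨x, hxT, hx0, hx⟩ := exists_ne_zero_mem_orthogonal_of_odd_finrank h₀
      (show Odd (finrank K T) from hT ▸ odd_two_mul_add_one m)
    obtain ⟨f, hf⟩ : ∃ f : Dual K V, f x ≠ 0 := by
      simpa using mt (Module.forall_dual_apply_eq_zero_iff K x).mp hx0
    -- `B₁ x` makes a subspace orthogonal to `x` for `B₁`, and `f` makes it avoid `x`.
    let F : T →ₗ[K] K × K := ((B₁ x).prod f).domRestrict T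
    have hker : 2 * m ≤ finrank K ((LinearMap.ker F).map T.subtype) + 1 := by
      have hrange := (LinearMap.range F).finrank_le
      have hadd := F.finrank_range_add_finrank_ker
      rw [finrank_prod, finrank_self] at hrange
      rw [Submodule.finrank_map_subtype_eq]
      omega
    obtain ⟨W, hWker, hW, hW₀, hW₁⟩ := ih hker
    have hWT : W ≤ T := hWker.trans (Submodule.map_subtype_le _ _)
    have hWF : ∀ w ∈ W, B₁ x w = 0 ∧ f w = 0 := fun w hw => by
      obtain ⟨u, hu, rfl⟩ := hWker hw
      exact Prod.mk.inj hu
    have hxW : x ∉ W := fun h => hf (hWF x h).2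
    have hx₀ : x ∈ B₀.orthogonal W := fun w hw => hx w (hWT hw)
    have hx₁ : x ∈ B₁.orthogonal W := fun w hw => h₁.isRefl.eq_zero (hWF w hw).1
    exact ⟨W ⊔ K ∙ x,
      sup_le (hWT.trans hTS) ((Submodule.span_singleton_le_iff_mem x S).mpr (hTS hxT)),
      by rw [Submodule.finrank_sup_span_singleton hxW, hW],
      sup_span_singleton_le_orthogonal h₀ hW₀ hx₀, sup_span_singleton_le_orthogonal h₁ hW₁ hx₁⟩

end AlternatingForm

/-! ### Quadratic forms in characteristic two -/

theorem exists_quadraticForm_eq_aeval {R S σ : Type*} [CommRing R] [CommRing S] [Algebra R S]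
    {f : MvPolynomial σ R} (hf : f.IsHomogeneous 2) :
    ∃ Q : QuadraticForm S (σ → S), ∀ v, Q v = MvPolynomial.aeval v f := by
  have hlin : ∀ l ∈ MvPolynomial.homogeneousSubmodule σ R 1,
      ∃ φ : Dual S (σ → S), ∀ v, φ v = MvPolynomial.aeval v l := by
    intro l hl
    rw [MvPolynomial.homogeneousSubmodule_one_eq_span_X] at hl
    induction hl using Submodule.span_induction with
    | mem _ hx =>
      obtain ⟨i, rfl⟩ := hx
      exact ⟨LinearMap.proj i, fun v => (MvPolynomial.aeval_X v i).symm⟩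
    | zero => exact ⟨0, fun v => by simp⟩
    | add x y _ _ hx hy =>
      obtain ⟨φ, hφ⟩ := hx
      obtain ⟨ψ, hψ⟩ := hy
      exact ⟨φ + ψ, fun v => by simp [hφ, hψ]⟩
    | smul c x _ hx =>
      obtain ⟨φ, hφ⟩ := hx
      exact ⟨algebraMap R S c • φ, fun v => by simp [hφ, Algebra.smul_def]⟩
  rw [← MvPolynomial.mem_homogeneousSubmodule, ← MvPolynomial.homogeneousSubmodule_one_pow,
    pow_two] at hf
  induction hf using Submodule.mul_induction_on' with
  | mem_mul_mem x hx y hy =>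
    obtain ⟨φ, hφ⟩ := hlin x hx
    obtain ⟨ψ, hψ⟩ := hlin y hy
    exact ⟨QuadraticMap.linMulLin φ ψ, fun v => by simp [hφ, hψ]⟩
  | add x _ y _ hx hy =>
    obtain ⟨Q, hQ⟩ := hx
    obtain ⟨Q', hQ'⟩ := hy
    exact ⟨Q + Q', fun v => by simp [hQ, hQ']⟩

theorem isAlt_polarBilin {R M : Type*} [CommRing R] [CharP R 2] [AddCommGroup M] [Module R M]
    (Q : QuadraticForm R M) : Q.polarBilin.IsAlt := fun x => by
  rw [QuadraticMap.polarBilin_apply_apply, QuadraticMap.polar_self, two_smul,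
    CharTwo.add_self_eq_zero]

theorem map_sum_smul_of_polar_eq_zero {R M κ : Type*} [CommRing R] [AddCommGroup M] [Module R M]
    [Fintype κ] (Q : QuadraticForm R M) {v : κ → M}
    (hv : Pairwise fun i j => QuadraticMap.polar Q (v i) (v j) = 0) (y : κ → R) :
    Q (∑ j, y j • v j) = ∑ j, y j ^ 2 * Q (v j) := by
  classical
  rw [QuadraticMap.map_sum, Finset.sum_eq_zero (s := Finset.filter _ _), add_zero]
  · simp only [QuadraticMap.map_smul, smul_eq_mul, pow_two]
  · rintro ⟨i, j⟩ hij
    have h : QuadraticMap.polar Q (v i) (v j) = 0 := hv (by simpa using hij)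
    simp [QuadraticMap.polar_smul_left, QuadraticMap.polar_smul_right, h]

theorem exists_ne_zero_forall_eq_zero_of_isSquare {L V ι κ : Type*} [Field L] [CharP L 2]
    [AddCommGroup V] [Module L V] [Fintype ι] [Fintype κ] (hcard : Fintype.card ι < Fintype.card κ)
    (Q : ι → QuadraticForm L V) {v : κ → V} (hv : LinearIndependent L v)
    (hpolar : ∀ l, Pairwise fun i j => QuadraticMap.polar (Q l) (v i) (v j) = 0)
    (hsq : ∀ l j, IsSquare (Q l (v j))) : ∃ x, x ≠ 0 ∧ ∀ l, Q l x = 0 := by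
  choose s hs using hsq
  obtain ⟨y, hy, hy0⟩ := Submodule.exists_mem_ne_zero_of_ne_bot
    (LinearMap.ker_ne_bot_of_finrank_lt (f := (Matrix.of s).mulVecLin) (by simpa using hcard))
  refine ⟨∑ j, y j • v j, fun h => hy0 (funext (Fintype.linearIndependent_iff.mp hv y h)),
    fun l => ?_⟩
  have hl : ∑ j, s l j * y j = 0 := congrFun hy l
  calc Q l (∑ j, y j • v j) = ∑ j, y j ^ 2 * Q l (v j) :=
        map_sum_smul_of_polar_eq_zero (Q l) (hpolar l) y
    _ = ∑ j, (s l j * y j) ^ 2 := Finset.sum_congr rfl fun j _ => by rw [hs]; ring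
    _ = 0 := by rw [← CharTwo.sum_sq, hl, zero_pow two_ne_zero]

theorem exists_ne_zero_forall_aeval_eq_zero {k L σ : Type*} [Field k] [CharP k 2] [Field L]
    [Algebra k L] (hL : ∀ c : k, IsSquare (algebraMap k L c)) [Fintype σ]
    (hσ : 5 ≤ Fintype.card σ) {f : Fin 2 → MvPolynomial σ k} (hf : ∀ i, (f i).IsHomogeneous 2) :
    ∃ a : σ → L, a ≠ 0 ∧ ∀ i, MvPolynomial.aeval a (f i) = 0 := by
  have : CharP L 2 := charP_of_injective_algebraMap (algebraMap k L).injective 2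
  choose Q hQ using fun i => exists_quadraticForm_eq_aeval (S := k) (hf i)
  choose QL hQL using fun i => exists_quadraticForm_eq_aeval (S := L) (hf i)
  have hbase : ∀ i u, QL i (algebraMap k L ∘ u) = algebraMap k L (Q i u) := fun i u => by
    rw [hQL, hQ, MvPolynomial.aeval_algebraMap_apply]
  obtain ⟨W, -, hW, hW₀, hW₁⟩ := exists_isotropic_of_two_mul_le_finrank_add_one (m := 3) (S := ⊤)
    (isAlt_polarBilin (Q 0)) (isAlt_polarBilin (Q 1)) (by simpa using hσ)
  have : Module.Finite k W := Module.finite_of_finrank_pos (by omega)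
  let v := Module.finBasisOfFinrankEq k W hW
  have hv : LinearIndependent k fun j => (v j : σ → k) :=
    v.linearIndependent.map' W.subtype W.ker_subtype
  have hpolar : ∀ l i j, QuadraticMap.polar (Q l) (v i) (v j) = 0 :=
    Fin.forall_fin_two.mpr ⟨fun i j => hW₀ (v j).2 _ (v i).2, fun i j => hW₁ (v j).2 _ (v i).2⟩
  have hpolarL : ∀ l i j,
      QuadraticMap.polar (QL l) (algebraMap k L ∘ v i) (algebraMap k L ∘ v j) = 0 := by
    intro l i j
    have hadd : algebraMap k L ∘ v i + algebraMap k L ∘ v j =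
        algebraMap k L ∘ (v i + v j : σ → k) := by
      ext m
      simp
    rw [QuadraticMap.polar, hadd, hbase, hbase, hbase, ← map_sub, ← map_sub]
    exact (congrArg _ (hpolar l i j)).trans (map_zero _)
  obtain ⟨x, hx0, hx⟩ := exists_ne_zero_forall_eq_zero_of_isSquare (by simp) QL
    (v := fun j => algebraMap k L ∘ v j)
    (linearIndependent_algebraMap_comp_iff.mpr hv) (fun l i j _ => hpolarL l i j)
    (fun l j => by rw [hbase]; exact hL _)
  exact ⟨x, hx0, fun i => by rw [← hQL, hx]⟩

/-! ### Points of projective spectra -/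

theorem exists_specMap_comp_toSpecZero {R A B : Type u} [CommRing R] [CommRing A] [Algebra R A]
    [CommRing B] [Algebra R B] (𝒜 : ℕ → Submodule R A) [GradedAlgebra 𝒜] {m : ℕ} (hm : 0 < m)
    {f : A} (hf : f ∈ 𝒜 m) (φ : A →ₐ[R] B) (hφ : IsUnit (φ f)) :
    ∃ x : Spec (CommRingCat.of B) ⟶ Proj 𝒜,
      x ≫ Proj.toSpecZero 𝒜 ≫ Spec.map (CommRingCat.ofHom (algebraMap R (𝒜 0))) =
        Spec.map (CommRingCat.ofHom (algebraMap R B)) := by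
  let ψ : HomogeneousLocalization.Away 𝒜 f →+* B :=
    (IsLocalization.Away.lift (S := Localization.Away f) (g := φ.toRingHom) f hφ).comp
      (algebraMap (HomogeneousLocalization.Away 𝒜 f) (Localization.Away f))
  have hψ : (ψ.comp (HomogeneousLocalization.fromZeroRingHom 𝒜 _)).comp
      (algebraMap R (𝒜 0)) = algebraMap R B := by
    ext c
    exact (IsLocalization.Away.lift_eq f hφ (algebraMap R A c)).trans (φ.commutes c)
  refine ⟨Spec.map (CommRingCat.ofHom ψ) ≫ Proj.awayι 𝒜 f hf hm, ?_⟩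
  rw [Category.assoc, Proj.awayι_toSpecZero_assoc, ← Spec.map_comp, ← Spec.map_comp, ← hψ]
  rfl

namespace QuadricPair

theorem nonempty_point_of_aeval_eq_zero {k : Type u} [Field k] (X : QuadricPair k) {L : Type u}
    [Field L] [Algebra k L] {a : Fin 5 → L} (ha : a ≠ 0)
    (h : ∀ i, MvPolynomial.aeval a (X.form i) = 0) : Nonempty (X.Point L) := by
  obtain ⟨j, hj⟩ := Function.ne_iff.mp ha
  have hideal : X.ideal ≤ RingHom.ker (MvPolynomial.aeval a : MvPolynomial (Fin 5) k →ₐ[k] L) :=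
    Ideal.span_le.mpr (Set.range_subset_iff.mpr h)
  let φ : X.CoordRing →ₐ[k] L := Ideal.Quotient.liftₐ X.ideal (MvPolynomial.aeval a) hideal
  have hφ : φ (Ideal.Quotient.mk X.ideal (MvPolynomial.X j)) = a j :=
    MvPolynomial.aeval_X a j
  obtain ⟨x, hx⟩ := exists_specMap_comp_toSpecZero X.grading one_pos
    (X.mk_mem_grading (MvPolynomial.isHomogeneous_X k j)) φ (hφ ▸ Ne.isUnit hj)
  exact ⟨⟨x, hx⟩⟩

theorem nonempty_point_of_forall_isSquare {k : Type u} [Field k] [CharP k 2] (X : QuadricPair k)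
    {L : Type u} [Field L] [Algebra k L] (hL : ∀ c : k, IsSquare (algebraMap k L c)) :
    Nonempty (X.Point L) := by
  obtain ⟨a, ha, haX⟩ := exists_ne_zero_forall_aeval_eq_zero hL (by simp) X.isHomogeneous
  exact X.nonempty_point_of_aeval_eq_zero ha haX

end QuadricPair

/-! ### Expansions in complete rings of characteristic `p` -/

theorem isPrecomplete_pi {R ι : Type*} [CommRing R] [Finite ι] (I : Ideal R) (M : ι → Type*)
    [∀ i, AddCommGroup (M i)] [∀ i, Module R (M i)] [∀ i, IsPrecomplete I (M i)] :
    IsPrecomplete I (∀ i, M i) := by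
  classical
  have := Fintype.ofFinite ι
  refine AdicCompletion.of_surjective_iff.mp fun y => ?_
  choose x hx using fun i => AdicCompletion.of_surjective I (M i) (AdicCompletion.pi I M y i)
  refine ⟨x, (AdicCompletion.piEquivOfFintype I M).injective (funext fun i => ?_)⟩
  rw [AdicCompletion.piEquivOfFintype_apply, AdicCompletion.piEquivOfFintype_apply, ← hx]
  rfl

theorem exists_eq_sum_map_mul_of_forall_sub_mem {R S ι : Type*} [CommRing R] [CommRing S]
    [Fintype ι] (φ : R →+* S) (I : Ideal R) [IsPrecomplete I R] [hS : IsHausdorff (I.map φ) S]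
    {s : ι → S} (h : ∀ x, ∃ a : ι → R, x - ∑ i, φ (a i) * s i ∈ I.map φ) (x : S) :
    ∃ a : ι → R, x = ∑ i, φ (a i) * s i := by
  let _ : Algebra R S := φ.toAlgebra
  have : IsHausdorff I S := IsHausdorff.map_algebraMap_iff.mp hS
  have : IsPrecomplete I (ι → R) := isPrecomplete_pi I fun _ => R
  have hsum : ∀ a, Fintype.linearCombination R s a = ∑ i, φ (a i) * s i := fun a => by
    simp only [Fintype.linearCombination_apply, Algebra.smul_def]
    rfl
  have hsurj : Function.Surjective
      ((I • ⊤ : Submodule R S).mkQ ∘ₗ Fintype.linearCombination R s) := by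
    intro y
    obtain ⟨y, rfl⟩ := Submodule.mkQ_surjective _ y
    obtain ⟨a, ha⟩ := h y
    refine ⟨a, ((Submodule.Quotient.eq _).mpr ?_).symm⟩
    rw [Ideal.smul_top_eq_map, hsum]
    exact ha
  obtain ⟨a, rfl⟩ := surjective_of_mkQ_comp_surjective hsurj x
  exact ⟨a, hsum a⟩

theorem exists_pow_dvd_sub_sum_pow_mul {R : Type*} [CommRing R] {π : R} {q : ℕ}
    (h : ∀ x, ∃ a, π ∣ x - a ^ q) (n : ℕ) (x : R) :
    ∃ a : Fin n → R, π ^ n ∣ x - ∑ i, a i ^ q * π ^ (i : ℕ) := by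
  induction n with
  | zero => exact ⟨Fin.elim0, by simp⟩
  | succ n ih =>
    obtain ⟨a, y, hy⟩ := ih
    obtain ⟨b, z, hz⟩ := h y
    refine ⟨Fin.snoc a b, z, ?_⟩
    simp only [Fin.sum_univ_castSucc, Fin.snoc_castSucc, Fin.snoc_last, Fin.val_castSucc,
      Fin.val_last]
    linear_combination hy + π ^ n * hz

theorem exists_eq_sum_pow_mul_of_isAdicComplete {R : Type*} [CommRing R] {p : ℕ} [ExpChar R p]
    {π : R} [IsAdicComplete (Ideal.span {π}) R] (h : ∀ x, ∃ a, π ∣ x - a ^ p) (x : R) :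
    ∃ a : Fin p → R, x = ∑ i, a i ^ p * π ^ (i : ℕ) := by
  have hmap : (Ideal.span {π}).map (frobenius R p) = Ideal.span {π ^ p} := by
    rw [Ideal.map_span, Set.image_singleton, frobenius_def]
  have : IsHausdorff ((Ideal.span {π}).map (frobenius R p)) R := by
    refine IsHausdorff.of_map (S := R) (J := Ideal.span {π}) ?_
    rw [hmap, Algebra.algebraMap_self, Ideal.map_id]
    exact Ideal.span_singleton_le_span_singleton.mpr (dvd_pow_self π (expChar_pos R p).ne')
  -- Through the Frobenius map, the ideal `(π)` acts on `R` as `(π ^ p)`, so that it is enough to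
  -- expand modulo `π ^ p`.
  refine exists_eq_sum_map_mul_of_forall_sub_mem (frobenius R p) (Ideal.span {π}) (fun y => ?_) x
  obtain ⟨a, ha⟩ := exists_pow_dvd_sub_sum_pow_mul h p y
  exact ⟨a, by rwa [hmap, Ideal.mem_span_singleton]⟩

/-! ### The degree of `k^{1/p}` over `k` -/

theorem finrank_adjoinPthRoots_eq_of_closure_eq_top {p : ℕ} [Fact p.Prime] {k : Type*} [Field k]
    [CharP k p] {t : k} (ht : ∀ a, a ^ p ≠ t)
    (h : Subfield.closure (insert t (Set.range fun a : k => a ^ p)) = ⊤) :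
    finrank k (AdjoinPthRoots k) = p := by
  have hp : p.Prime := Fact.out
  have : ExpChar k p := ExpChar.prime hp
  let α := AdjoinPthRoots.root k t
  have hα : α ^ p = algebraMap k (AdjoinPthRoots k) t := by
    rw [AdjoinPthRoots.root_pow p]
  have hmonic : (Polynomial.X ^ p - Polynomial.C t).Monic :=
    Polynomial.monic_X_pow_sub_C t hp.ne_zero
  have hminpoly : minpoly k α = Polynomial.X ^ p - Polynomial.C t :=
    (minpoly.eq_of_irreducible_of_monic (X_pow_sub_C_irreducible_of_prime hp ht)
      (by simp [hα]) hmonic).symm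
  have hle : Subfield.closure (insert t (Set.range fun a : k => a ^ p)) ≤
      (IntermediateField.adjoin k {α}).toSubfield.comap (AdjoinPthRoots.root k).toRingHom := by
    rw [Subfield.closure_le, Set.insert_subset_iff, Set.range_subset_iff]
    refine ⟨IntermediateField.mem_adjoin_simple_self k α, fun a => ?_⟩
    change AdjoinPthRoots.root k (a ^ p) ∈ IntermediateField.adjoin k {α}
    rw [map_pow, AdjoinPthRoots.root_pow p]
    exact IntermediateField.algebraMap_mem _ a
  have htop : IntermediateField.adjoin k {α} = ⊤ := by
    refine eq_top_iff.mpr fun x _ => ?_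
    obtain ⟨y, rfl⟩ := (AdjoinPthRoots.root k).surjective x
    exact hle (h ▸ Subfield.mem_top y)
  rw [← IntermediateField.finrank_top', ← htop, IntermediateField.adjoin.finrank
    (minpoly.ne_zero_iff.mp (hminpoly ▸ hmonic.ne_zero)), hminpoly,
    Polynomial.natDegree_X_pow_sub_C]

theorem finrank_adjoinPthRoots_of_finiteDimensional (p : ℕ) (E : Type*) {k : Type*} [Field E]
    [Field k] [Algebra E k] [FiniteDimensional E k] [ExpChar E p] [ExpChar k p] :
    finrank k (AdjoinPthRoots k) = finrank E (AdjoinPthRoots E) := by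
  -- The two root maps identify `k / E` with `AdjoinPthRoots k / AdjoinPthRoots E`.
  let rE := AdjoinPthRoots.root E
  let rk := AdjoinPthRoots.root k
  let _ : Algebra (AdjoinPthRoots E) (AdjoinPthRoots k) :=
    ((rk.toRingHom.comp (algebraMap E k)).comp rE.symm.toRingHom).toAlgebra
  let _ : Algebra E (AdjoinPthRoots k) :=
    ((algebraMap k (AdjoinPthRoots k)).comp (algebraMap E k)).toAlgebra
  have : IsScalarTower E k (AdjoinPthRoots k) := IsScalarTower.of_algebraMap_eq fun _ => rfl
  have hroot : ∀ y : E, algebraMap (AdjoinPthRoots E) (AdjoinPthRoots k) (rE y) =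
      rk (algebraMap E k y) := fun y =>
    congrArg (fun z => rk (algebraMap E k z)) (rE.symm_apply_apply y)
  have : IsScalarTower E (AdjoinPthRoots E) (AdjoinPthRoots k) :=
    IsScalarTower.of_algebraMap_eq fun x => by
      change algebraMap k (AdjoinPthRoots k) (algebraMap E k x) = _
      rw [← AdjoinPthRoots.root_pow p, ← AdjoinPthRoots.root_pow p, map_pow, hroot]
  have hroots : finrank E k = finrank (AdjoinPthRoots E) (AdjoinPthRoots k) :=
    Algebra.finrank_eq_of_equiv_equiv rE rk (RingHom.ext hroot)
  have htower := (finrank_mul_finrank E k (AdjoinPthRoots k)).trans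
    (finrank_mul_finrank E (AdjoinPthRoots E) (AdjoinPthRoots k)).symm
  rw [← hroots, mul_comm] at htower
  exact Nat.eq_of_mul_eq_mul_right finrank_pos htower

theorem pow_ne_algebraMap_of_irreducible {R K : Type*} [CommRing R] [IsDomain R]
    [IsIntegrallyClosed R] [Field K] [Algebra R K] [IsFractionRing R K] {π : R}
    (hπ : Irreducible π) {n : ℕ} (hn : n ≠ 1) (a : K) : a ^ n ≠ algebraMap R K π := by
  intro ha
  rcases Nat.eq_zero_or_pos n with rfl | hpos
  · rw [pow_zero, ← map_one (algebraMap R K)] at ha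
    exact hπ.ne_one (IsFractionRing.injective R K ha).symm
  · obtain ⟨b, rfl⟩ := IsIntegrallyClosed.exists_algebraMap_eq_of_isIntegral_pow (R := R) hpos
      (ha ▸ isIntegral_algebraMap)
    rw [← map_pow] at ha
    exact not_irreducible_pow hn (IsFractionRing.injective R K ha ▸ hπ)

theorem finrank_adjoinPthRoots_of_isFractionRing {p : ℕ} [Fact p.Prime] {R : Type*} (K : Type*)
    [CommRing R] [IsDomain R] [IsIntegrallyClosed R] [Field K] [CharP K p] [Algebra R K]
    [IsFractionRing R K] {π : R} (hπ : Irreducible π)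
    (h : Subring.closure (insert π (Set.range fun a : R => a ^ p)) = ⊤) :
    finrank K (AdjoinPthRoots K) = p := by
  refine finrank_adjoinPthRoots_eq_of_closure_eq_top (t := algebraMap R K π)
    (pow_ne_algebraMap_of_irreducible hπ (Fact.out : p.Prime).ne_one) (eq_top_iff.mpr fun x _ => ?_)
  have hR : Subring.closure (insert π (Set.range fun a : R => a ^ p)) ≤
      (Subfield.closure (insert (algebraMap R K π) (Set.range fun a : K => a ^ p))).toSubring.comap
        (algebraMap R K) := by
    rw [Subring.closure_le, Set.insert_subset_iff, Set.range_subset_iff]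
    exact ⟨Subfield.subset_closure (Set.mem_insert _ _), fun a =>
      Subfield.subset_closure (Set.mem_insert_of_mem _ ⟨algebraMap R K a, (map_pow _ a p).symm⟩)⟩
  obtain ⟨a, b, -, rfl⟩ := IsFractionRing.div_surjective (A := R) x
  exact div_mem (hR (h ▸ Subring.mem_top a)) (hR (h ▸ Subring.mem_top b))

theorem closure_insert_X_range_pow_eq_top (p : ℕ) {F : Type*} [Field F] [ExpChar F p]
    [PerfectRing F p] :
    Subring.closure (insert Polynomial.X (Set.range fun f : Polynomial F => f ^ p)) = ⊤ := by
  refine eq_top_iff.mpr fun f _ => ?_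
  have hX : Polynomial.X ∈
      Subring.closure (insert Polynomial.X (Set.range fun f : Polynomial F => f ^ p)) :=
    Subring.subset_closure (Set.mem_insert _ _)
  induction f using Polynomial.induction_on' with
  | add f g hf hg => exact add_mem (hf trivial) (hg trivial)
  | monomial n c =>
    obtain ⟨d, rfl⟩ := surjective_frobenius F p c
    rw [frobenius_def, ← Polynomial.C_mul_X_pow_eq_monomial, map_pow]
    exact mul_mem (Subring.subset_closure (Set.mem_insert_of_mem _ ⟨Polynomial.C d, rfl⟩))
      (pow_mem hX n)

theorem finrank_adjoinPthRoots_ratFunc (p : ℕ) [Fact p.Prime] {F : Type*} [Field F] [CharP F p]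
    [PerfectRing F p] : finrank (RatFunc F) (AdjoinPthRoots (RatFunc F)) = p :=
  have : CharP (RatFunc F) p :=
    charP_of_injective_algebraMap (algebraMap F (RatFunc F)).injective p
  finrank_adjoinPthRoots_of_isFractionRing (RatFunc F) (Polynomial.irreducible_X (R := F))
    (closure_insert_X_range_pow_eq_top p)

theorem finrank_adjoinPthRoots_of_isDiscreteValuationRing {p : ℕ} [Fact p.Prime] (O K : Type*)
    [CommRing O] [IsDomain O] [IsDiscreteValuationRing O]
    [IsAdicComplete (IsLocalRing.maximalIdeal O) O] [PerfectField (IsLocalRing.ResidueField O)]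
    [Field K] [CharP K p] [Algebra O K] [IsFractionRing O K] :
    finrank K (AdjoinPthRoots K) = p := by
  have hp : p.Prime := Fact.out
  have : CharP O p := (algebraMap O K).charP (IsFractionRing.injective O K) p
  have : ExpChar O p := ExpChar.prime hp
  have : CharP (IsLocalRing.ResidueField O) p :=
    ringChar.of_eq (CharP.ringChar_of_prime_eq_zero hp
      (by rw [← map_natCast (IsLocalRing.residue O), CharP.cast_eq_zero, map_zero]))
  have : ExpChar (IsLocalRing.ResidueField O) p := ExpChar.prime hp
  have : PerfectRing (IsLocalRing.ResidueField O) p := inferInstance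
  obtain ⟨π, hπ⟩ := IsDiscreteValuationRing.exists_irreducible O
  have : IsAdicComplete (Ideal.span {π}) O := by rwa [← hπ.maximalIdeal_eq]
  have hres : ∀ x : O, ∃ a, π ∣ x - a ^ p := by
    intro x
    obtain ⟨b, hb⟩ := surjective_frobenius (IsLocalRing.ResidueField O) p (IsLocalRing.residue O x)
    obtain ⟨a, rfl⟩ := IsLocalRing.residue_surjective b
    refine ⟨a, ?_⟩
    rw [← Ideal.mem_span_singleton, ← hπ.maximalIdeal_eq, ← IsLocalRing.residue_eq_zero_iff,
      map_sub, map_pow, sub_eq_zero, ← hb, frobenius_def]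
  refine finrank_adjoinPthRoots_of_isFractionRing K hπ (eq_top_iff.mpr fun x _ => ?_)
  obtain ⟨a, rfl⟩ := exists_eq_sum_pow_mul_of_isAdicComplete hres x
  exact sum_mem fun i _ => mul_mem
    (Subring.subset_closure (Set.mem_insert_of_mem _ ⟨a i, rfl⟩))
    (pow_mem (Subring.subset_closure (Set.mem_insert _ _)) _)

theorem finrank_adjoinPthRoots_of_isNonarchimedeanLocalField (p : ℕ) [Fact p.Prime] (k : Type*)
    [Field k] [CharP k p] [ValuativeRel k] [TopologicalSpace k] [IsNonarchimedeanLocalField k] :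
    finrank k (AdjoinPthRoots k) = p :=
  let _ := IsTopologicalAddGroup.rightUniformSpace k
  have := isUniformAddGroup_of_addCommGroup (G := k)
  finrank_adjoinPthRoots_of_isDiscreteValuationRing (ValuativeRel.valuation k).integer k

theorem IsLocalField.finrank_adjoinPthRoots (p : ℕ) [Fact p.Prime] {k : Type*} [Field k] [CharP k p]
    (hk : IsLocalField k) : finrank k (AdjoinPthRoots k) = p := by
  have hp : p.Prime := Fact.out
  have hzero : ∀ (F : Type) [Field F] [CharZero F], IsEmpty (k ≃+* F) := fun F _ _ => ⟨fun e =>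
    hp.ne_zero (((e : k →+* F).charP_iff_charP p).mp inferInstance |>.eq F (CharP.ofCharZero F))⟩
  obtain ⟨_, _, _⟩ | ⟨⟨e⟩⟩ | ⟨⟨e⟩⟩ := hk
  · exact finrank_adjoinPthRoots_of_isNonarchimedeanLocalField p k
  · exact (hzero ℝ).elim e
  · exact (hzero ℂ).elim e

theorem IsGlobalField.finrank_adjoinPthRoots (p : ℕ) [Fact p.Prime] {k : Type*} [Field k]
    [CharP k p] (hk : IsGlobalField k) : finrank k (AdjoinPthRoots k) = p := by
  have hp : p.Prime := Fact.out
  obtain hk | ⟨F, _, _, _, hk⟩ := hk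
  · exact absurd (CharP.eq k ‹CharP k p› (CharP.ofCharZero k)) hp.ne_zero
  · have : CharP (RatFunc F) p :=
      (algebraMap (RatFunc F) k).charP (algebraMap (RatFunc F) k).injective p
    have : CharP F p := (algebraMap F (RatFunc F)).charP (algebraMap F (RatFunc F)).injective p
    have : ExpChar (RatFunc F) p := ExpChar.prime hp
    have : ExpChar k p := ExpChar.prime hp
    have : ExpChar F p := ExpChar.prime hp
    rw [finrank_adjoinPthRoots_of_finiteDimensional p (RatFunc F), finrank_adjoinPthRoots_ratFunc p]

theorem mainTheorem9_general (k : Type u) [Field k] [CharP k 2] :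
    (∀ X : QuadricPair k, Nonempty (X.Point (AdjoinPthRoots k))) ∧
    (IsLocalField k ∨ IsGlobalField k →
      finrank k (AdjoinPthRoots k) = 2 ∧
      ∀ X : QuadricPair k, ∃ (K : Type u) (_ : Field K) (_ : Algebra k K),
        finrank k K = 2 ∧ Nonempty (X.Point K)) := by
  have : ExpChar k 2 := ExpChar.prime Nat.prime_two
  have hpoint : ∀ X : QuadricPair k, Nonempty (X.Point (AdjoinPthRoots k)) := fun X =>
    X.nonempty_point_of_forall_isSquare fun c =>
      ⟨AdjoinPthRoots.root k c, by rw [← pow_two, AdjoinPthRoots.root_pow 2]⟩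
  refine ⟨hpoint, fun hk => ?_⟩
  have hdegree : finrank k (AdjoinPthRoots k) = 2 :=
    hk.elim (IsLocalField.finrank_adjoinPthRoots 2) (IsGlobalField.finrank_adjoinPthRoots 2)
  exact ⟨hdegree, fun X => ⟨AdjoinPthRoots k, inferInstance, inferInstance, hdegree, hpoint X⟩⟩

/-- Here `AdjoinPthRoots k`, for `k` of characteristic two, is the extension `k^{1/2}` of `k`
obtained by adjoining the square roots of all elements of `k`. -/
theorem mainTheorem9 (k : Type u) [Field k] [CharP k 2] :
    (∀ X : QuadricPair k, X.IsSmoothCompleteIntersection →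
      Nonempty (X.Point (AdjoinPthRoots k))) ∧
    (IsLocalField k ∨ IsGlobalField k →
      Module.finrank k (AdjoinPthRoots k) = 2 ∧
      ∀ X : QuadricPair k, X.IsSmoothCompleteIntersection →
        ∃ (K : Type u) (_ : Field K) (_ : Algebra k K),
          Module.finrank k K = 2 ∧ Nonempty (X.Point K)) := by
  obtain ⟨hpoint, hdegree⟩ := mainTheorem9_general k
  exact ⟨fun X _ => hpoint X, fun hk => (hdegree hk).imp_right fun h X _ => h X⟩
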